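/- Let $n\ge 1$ and let $\mathcal L$ be the path with vertices $v_1,\dots,v_n$ and edges $\{v_1,v_2\},\dots,\{v_{n-1},v_n\}$. For $1\le i\le n$ let $T_i:\mathbb Z^n\to\mathbb Z^n$ be the toppling $T_i(\alpha)=\alpha-d_i\epsilon_i+\sum_{\{v_i,v_j\}\in E(\mathcal L)}\epsilon_j$, where $d_i$ is the degree of $v_i$ and $\epsilon_1,\dots,\epsilon_n$ is the standard basis of $\mathbb Z^n$. The topplings commute; let $G$ be the group which they generate. Put $T_{[i]}=T_1T_2\cdots T_i$ and, for $1\le i<j\le n$, $T_{[i,j]}=T_{[i]}T_{[i+1]}\cdots T_{[j-1]}$. For $\alpha,\beta\in\mathbb Z^n$ let $C_{\alpha,\beta}$ be the number of decompositions (as products of the generators $T_{[i,j]}$, $1\le i<j\le n$, repetitions allowed, order of the factors disregarded) of the unique $g\in G$ with $g(\alpha)=\beta$; $C_{\alpha,\beta}=0$ if there is no such $g$ or no such decomposition. Theorem. Let $\lambda$ and $\mu$ be integer partitions with at most $n$ parts, regarded as vectors in $\mathbb Z^n$, and assume that $\lambda$ dominates $\mu$, that is, $\mu=T_1^{\nu_1}\cdots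 T_n^{\nu_n}(\lambda)$ for some integers $\nu_1\ge\dots\ge\nu_n\ge 0$ (for partitions this is the usual dominance order). Let $K_{\lambda,\mu}$ be the Kostka number, i.e. the number of semistandard Young tableaux of shape $\lambda$ and weight $\mu$. Then \[K_{\lambda,\mu}=\sum_{w\in\mathfrak S_n}(-1)^w\,C_{\,w(\lambda)+w(\delta)-\delta,\;\mu},\] where $\delta=(n-1,n-2,\dots,0)$, $(-1)^w$ is the sign of $w$, and $w$ acts on $\mathbb Z^n$ by permuting coordinates. -/

import Mathlib

noncomputable section

/-- The vector `Δ_i` added to a configuration when the vertex `i` is toppled: every neighbour of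
`i` gains `1` and `i` loses its degree. -/
def topplingVector {n : ℕ} (G : SimpleGraph (Fin n)) (i : Fin n) : Fin n → ℤ :=
  open scoped Classical in
  (∑ j ∈ G.neighborFinset i, Pi.single j (1 : ℤ)) - (G.degree i : ℤ) • Pi.single i (1 : ℤ)

/-- The toppling `T_i : α ↦ α + Δ_i`, as a bijection of the set of configurations. -/
def toppling {n : ℕ} (G : SimpleGraph (Fin n)) (i : Fin n) : Equiv.Perm (Fin n → ℤ) :=
  Equiv.addRight (topplingVector G i)

theorem toppling_comm {n : ℕ} (G : SimpleGraph (Fin n)) (i j : Fin n) :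
    toppling G i * toppling G j = toppling G j * toppling G i := by
  ext α k
  simp [toppling, Equiv.Perm.mul_apply, add_right_comm]

/-- The toppling group of `G`: the group of bijections of `ℤⁿ` generated by the topplings. -/
def topplingGroup {n : ℕ} (G : SimpleGraph (Fin n)) : Subgroup (Equiv.Perm (Fin n → ℤ)) :=
  Subgroup.closure (Set.range (toppling G))

theorem topplingGroup.isMulCommutative {n : ℕ} (G : SimpleGraph (Fin n)) :
    IsMulCommutative (topplingGroup G) :=
  Subgroup.isMulCommutative_closure (by
    rintro _ ⟨i, rfl⟩ _ ⟨j, rfl⟩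
    exact toppling_comm G i j)

/-- The toppling group is commutative, since the topplings commute with each other. -/
instance topplingGroup.instCommGroup {n : ℕ} (G : SimpleGraph (Fin n)) :
    CommGroup (topplingGroup G) :=
  { (topplingGroup G).toGroup with
    mul_comm := (topplingGroup.isMulCommutative G).is_comm.comm }

namespace topplingGroup

/-- The toppling `T_i` as an element of the toppling group. -/
def T {n : ℕ} (G : SimpleGraph (Fin n)) (i : Fin n) : topplingGroup G :=
  ⟨toppling G i, Subgroup.subset_closure ⟨i, rfl⟩⟩

/-- `T_{[i]} = T_1 T_2 ⋯ T_i` (vertices are numbered from `0` here). -/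
def TInit {n : ℕ} (G : SimpleGraph (Fin n)) (i : Fin n) : topplingGroup G :=
  ∏ k ∈ Finset.Iic i, T G k

/-- `T_{[i,j]} = T_{[i]} T_{[i+1]} ⋯ T_{[j-1]}`. -/
def TInterval {n : ℕ} (G : SimpleGraph (Fin n)) (i j : Fin n) : topplingGroup G :=
  ∏ k ∈ Finset.Ico i j, TInit G k

/-- The decompositions of `g` into the generators `T_{[i,j]}`, `i < j`. The group being
commutative, a decomposition is the multiset of the generators (given by their indices) in it. -/
def decompositions {n : ℕ} (G : SimpleGraph (Fin n)) (g : topplingGroup G) :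
    Set (Multiset {p : Fin n × Fin n // p.1 < p.2}) :=
  {s | (s.map fun p => TInterval G p.1.1 p.1.2).prod = g}

end topplingGroup

/-- `C_{α,β}`: the number of decompositions into the generators `T_{[i,j]}` of the element `g` of
the toppling group with `g(α) = β`. It is `0` if there is no such `g`, or if `g` has no
decomposition. (There is at most one such `g`, because all elements of the group are
translations.) -/
def decompositionCount {n : ℕ} (G : SimpleGraph (Fin n)) (α β : Fin n → ℤ) : ℕ :=
  {s | ∃ g : topplingGroup G, g.1 α = β ∧ s ∈ topplingGroup.decompositions G g}.ncard

/-- Toppling dominance `β ≤ α`: one has `β = T^ν(α)` for some `ν_1 ≥ ν_2 ≥ ⋯ ≥ ν_n ≥ 0`. -/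
def ToppleDominates {n : ℕ} (G : SimpleGraph (Fin n)) (α β : Fin n → ℤ) : Prop :=
  ∃ ν : Fin n → ℕ, Antitone ν ∧ (∏ i, topplingGroup.T G i ^ ν i).1 α = β

/-- The Kostka number `K_{λ,μ}`: the number of semistandard Young tableaux of shape `λ` and
weight `μ`. (The entries are numbered from `0`, as are the rows of `μ`.) -/
def kostkaNumber (lam mu : YoungDiagram) : ℕ :=
  {S : SemistandardYoungTableau lam |
    ∀ i : ℕ, (lam.cells.filter fun c => S c.1 c.2 = i).card = mu.rowLen i}.ncard

/-- A partition, written as a vector `(λ_1, …, λ_n)`, with zeros added at the end. -/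
def partVector (n : ℕ) (lam : YoungDiagram) : Fin n → ℤ := fun i => (lam.rowLen i : ℤ)

/-- The vector `δ = (n-1, n-2, …, 0)`. -/
def staircase (n : ℕ) : Fin n → ℤ := fun i => (n : ℤ) - 1 - (i : ℤ)

/-- The action of a permutation on vectors by permuting the coordinates. -/
def permuteVector {n : ℕ} (w : Equiv.Perm (Fin n)) (α : Fin n → ℤ) : Fin n → ℤ :=
  fun i => α (w⁻¹ i)

end

/-!
The generator `T_{[i,j]}` is the translation by `ε_j - ε_i` (`translationHom_TInterval`), so
`C_{α,β}` is the number `P(α - β)` of ways to write `α - β` as a sum of positive roots `ε_i - ε_j`,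
`i < j`, of type `A` (`decompositionCount_pathGraph`). The theorem thus becomes Kostant's weight
multiplicity formula `K_{λ,μ} = ∑_w (-1)^w P(w(λ+δ) - δ - μ)` for `GL_n`.

The formula is proved by induction on `n`, by showing that both sides obey the same branching rule.

On the side of the tableaux, the cells with the largest entry are removed. The remaining shape `ν`
interlaces with `λ`, that is, `λ_{i+1} ≤ ν_i ≤ λ_i`, and all interlacing shapes with the right number
of cells occur (`tableauCount_succ`).

On the other side, let `l = λ + δ`. Dropping the roots that involve the last coordinate writes `P` as
a sum of values of the partition function in dimension `n - 1` over an orthant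
(`kostantCount_succ`), and the alternating sum becomes
`∑_w (-1)^w ∑_a Q(a) ∏_i [a_i < l_{w⁻¹ i}]`, with `a` and `i` ranging over dimension `n - 1`. For
fixed `a` the sum over `w` is the determinant of the matrix `[a_i < l_j]` with a last row of ones
added. Subtracting adjacent columns turns it into the determinant of the matrix
`[l_{j+1} ≤ a_i < l_j]`, of size `n - 1`. What remains is a sum over the vectors `b` with
`l_{i+1} ≤ b_i < l_i` (`sum_sign_mul_sum_lt`), and with `b = ν + δ` these are exactly the interlacing
shapes (`signedKostantSum_succ`).
-/

/-! ### An alternating sum over orthants -/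

theorem sum_sign_mul_prod_inv {n : ℕ} (A : Matrix (Fin n) (Fin n) ℤ) :
    ∑ w : Equiv.Perm (Fin n), (Equiv.Perm.sign w : ℤ) * ∏ i, A i (w⁻¹ i) = A.det := by
  rw [Matrix.det_apply']
  refine Finset.sum_congr rfl fun w _ => ?_
  rw [← Equiv.prod_comp w fun i => A i (w⁻¹ i)]
  simp

/-- Subtracting adjacent columns makes the last row of ones a unit vector, and expanding along it
lowers the size of the determinant by one. -/
theorem det_of_lastRow_one {n : ℕ} (f : Fin n → Fin (n + 1) → ℤ) :
    Matrix.det (Matrix.of (Fin.snoc f (fun _ => 1) : Fin (n + 1) → Fin (n + 1) → ℤ)) =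
      Matrix.det (Matrix.of fun i j : Fin n => f i j.castSucc - f i j.succ) := by
  set A : Matrix (Fin (n + 1)) (Fin (n + 1)) ℤ := Matrix.of (Fin.snoc f (fun _ => 1)) with hA
  have hl : ∀ j, A (Fin.last n) j = 1 := fun j => by simp [hA]
  have hc : ∀ i j, A (Fin.castSucc i) j = f i j := fun i j => by simp [hA]
  -- Column `k + 1` of `B` is column `k + 1` minus column `k` of `A`, so that its last row is
  -- `(1, 0, …, 0)`; the two signs `(-1) ^ n`, of the cofactor and of the minor, cancel.
  let B : Matrix (Fin (n + 1)) (Fin (n + 1)) ℤ :=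
    Matrix.of fun i j => Fin.cases (A i 0) (fun k => A i k.succ - A i k.castSucc) j
  have hAB : A.det = B.det :=
    Matrix.det_eq_of_forall_col_eq_smul_add_pred (fun _ => 1) (fun i => by simp [B])
      (fun i j => by simp [B])
  rw [hAB, Matrix.det_succ_row B (Fin.last n), Finset.sum_eq_single 0]
  · have hminor : B.submatrix (Fin.last n).succAbove (Fin.succAbove 0) =
        -(Matrix.of fun i j : Fin n => f i j.castSucc - f i j.succ) := by
      ext i j
      simp [B, hc]
    rw [hminor, Matrix.det_neg]
    simp [B, hl, ← mul_assoc, ← mul_pow]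
  · intro j _ hj
    obtain ⟨k, rfl⟩ := Fin.exists_succ_eq.2 hj
    simp [B, hl]
  · simp

theorem permuteVector_mem_piFinset_const {n : ℕ} (s : Finset ℤ) (w : Equiv.Perm (Fin n))
    (a : Fin n → ℤ) :
    permuteVector w a ∈ Fintype.piFinset (fun _ => s) ↔ a ∈ Fintype.piFinset (fun _ => s) := by
  simp only [Fintype.mem_piFinset, permuteVector]
  exact ⟨fun h i => by simpa using h (w i), fun h i => h _⟩

/-- The action of a permutation on vectors, as a bijection. -/
def permuteVectorEquiv {n : ℕ} (w : Equiv.Perm (Fin n)) : (Fin n → ℤ) ≃ (Fin n → ℤ) where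
  toFun := permuteVector w
  invFun := permuteVector w⁻¹
  left_inv a := by ext i; simp [permuteVector]
  right_inv a := by ext i; simp [permuteVector]

/-- The alternating sum over `𝔖_{n+1}` of the sums of `Q` over the orthants `a_i < l_{w⁻¹ i}` equals
the alternating sum over `𝔖_n` of the sums of `Q` over the permuted copies of the box
`l_{i+1} ≤ b_i < l_i`: all other contributions cancel. The finite box `[L, M)ⁿ` only serves to make
the orthants finite. -/
theorem sum_sign_mul_sum_lt {n : ℕ} (Q : (Fin n → ℤ) → ℤ) (l : Fin (n + 1) → ℤ)
    (hl : Antitone l) (L M : ℤ) (hL : ∀ i, L ≤ l i) (hM : ∀ i, l i ≤ M) :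
    ∑ w : Equiv.Perm (Fin (n + 1)), (Equiv.Perm.sign w : ℤ) *
      ∑ a ∈ Fintype.piFinset (fun _ : Fin n => Finset.Ico L M),
        (if ∀ i, a i < l (w⁻¹ i.castSucc) then Q a else 0) =
    ∑ b ∈ Fintype.piFinset (fun i : Fin n => Finset.Ico (l i.succ) (l i.castSucc)),
      ∑ w : Equiv.Perm (Fin n), (Equiv.Perm.sign w : ℤ) * Q (permuteVector w b) := by
  have hdiff : ∀ (x : ℤ) (j : Fin n), (if x < l j.castSucc then (1 : ℤ) else 0) -
      (if x < l j.succ then 1 else 0) = if x ∈ Finset.Ico (l j.succ) (l j.castSucc) then 1 else 0 := by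
    intro x j
    have := hl (Fin.castSucc_le_succ j)
    simp only [Finset.mem_Ico]
    split_ifs <;> omega
  -- The contribution of a single point `a` is `Q a` times a determinant of indicator functions.
  have hprod : ∀ (a : Fin n → ℤ),
      ∑ w : Equiv.Perm (Fin (n + 1)), (Equiv.Perm.sign w : ℤ) *
        (if ∀ i, a i < l (w⁻¹ i.castSucc) then Q a else 0) =
      ∑ w : Equiv.Perm (Fin n), (Equiv.Perm.sign w : ℤ) *
        (if ∀ i, a (w i) ∈ Finset.Ico (l i.succ) (l i.castSucc) then Q a else 0) := by
    intro a
    have h1 := sum_sign_mul_prod_inv (Matrix.of (Fin.snoc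
      (fun (i : Fin n) (j : Fin (n + 1)) => if a i < l j then (1 : ℤ) else 0) (fun _ => 1)))
    rw [det_of_lastRow_one, Matrix.det_apply'] at h1
    simp only [hdiff, Fin.prod_univ_castSucc, Matrix.of_apply, Fin.snoc_castSucc, Fin.snoc_last,
      mul_one, Finset.prod_ite_zero, Finset.prod_const_one, Finset.mem_univ, true_imp_iff] at h1
    have h2 := congrArg (· * Q a) h1
    simp only [Finset.sum_mul, mul_assoc, ite_mul, one_mul, zero_mul] at h2
    exact h2
  simp only [Finset.mul_sum]
  rw [Finset.sum_comm, Finset.sum_congr rfl fun a _ => hprod a, Finset.sum_comm, Finset.sum_comm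
    (s := Fintype.piFinset _)]
  refine Finset.sum_congr rfl fun w _ => ?_
  simp only [← Finset.mul_sum]
  congr 1
  rw [← Finset.sum_filter]
  symm
  refine Finset.sum_equiv (permuteVectorEquiv w) (fun b => ?_) (fun b _ => rfl)
  rw [Finset.mem_filter]
  change _ ↔ permuteVector w b ∈ _ ∧ _
  rw [permuteVector_mem_piFinset_const]
  have hw : ∀ i, w⁻¹ (w i) = i := by simp
  simp only [Fintype.mem_piFinset, permuteVectorEquiv, Equiv.coe_fn_mk, permuteVector,
    hw, Finset.mem_Ico]
  exact ⟨fun h => ⟨fun i => ⟨(hL _).trans (h i).1, (h i).2.trans_le (hM _)⟩, h⟩, fun h => h.2⟩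

/-! ### The Kostant partition function -/

/-- The coefficients `c` express `γ` as `∑ c_{ij} (ε_i - ε_j)`, a combination of the positive roots
`ε_i - ε_j`, `i < j`, of type `A`. The coefficients are given as a strictly upper triangular
matrix. -/
def IsRootCombination {n : ℕ} (γ : Fin n → ℤ) (c : Fin n → Fin n → ℕ) : Prop :=
  (∀ i j, ¬ i < j → c i j = 0) ∧ ∀ i, ∑ j, (c i j : ℤ) - ∑ j, (c j i : ℤ) = γ i

/-- The Kostant partition function: the number of ways to write `γ` as a sum of positive roots
`ε_i - ε_j`, `i < j`. -/
noncomputable def kostantCount {n : ℕ} (γ : Fin n → ℤ) : ℕ := Nat.card {c // IsRootCombination γ c}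

namespace IsRootCombination

theorem sum_eq_zero {n : ℕ} {γ : Fin n → ℤ} {c : Fin n → Fin n → ℕ}
    (h : IsRootCombination γ c) : ∑ i, γ i = 0 := by
  simp only [← h.2, Finset.sum_sub_distrib]
  rw [Finset.sum_comm, sub_self]

/-- Dropping the roots `ε_i - ε_n` that involve the last coordinate. -/
theorem restrict {n : ℕ} {γ : Fin (n + 1) → ℤ} {c : Fin (n + 1) → Fin (n + 1) → ℕ}
    (h : IsRootCombination γ c) :
    IsRootCombination (fun i => γ i.castSucc - c i.castSucc (Fin.last n))
      (fun i j => c i.castSucc j.castSucc) := by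
  refine ⟨fun i j hij => h.1 _ _ (by simpa using hij), fun i => ?_⟩
  have h2 := h.2 i.castSucc
  rw [Fin.sum_univ_castSucc, Fin.sum_univ_castSucc,
    h.1 (Fin.last n) i.castSucc (Fin.castSucc_lt_last i).not_gt] at h2
  push_cast at h2
  linarith

/-- Adding the roots `ε_i - ε_n` with prescribed multiplicities `k_i`; the last coordinate comes out
right because the coordinates of `γ` have sum zero. -/
theorem extend {n : ℕ} {γ : Fin (n + 1) → ℤ} {a : Fin n → ℤ} {c : Fin n → Fin n → ℕ}
    (h : IsRootCombination a c) (k : Fin n → ℕ) (hk : ∀ i, a i + k i = γ i.castSucc)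
    (hγ : ∑ i, γ i = 0) :
    IsRootCombination γ (Fin.snoc (fun i => (Fin.snoc (c i) (k i) : Fin (n + 1) → ℕ))
      (fun _ => 0) : Fin (n + 1) → Fin (n + 1) → ℕ) := by
  constructor
  · intro i j hij
    induction i using Fin.lastCases with
    | last => simp
    | cast i =>
      induction j using Fin.lastCases with
      | last => exact absurd (Fin.castSucc_lt_last i) hij
      | cast j => simpa using h.1 i j (by simpa using hij)
  · intro i
    induction i using Fin.lastCases with
    | last =>
      have h0 := h.sum_eq_zero
      simp only [Fin.sum_univ_castSucc, ← hk, Finset.sum_add_distrib, h0, zero_add] at hγ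
      simp only [Fin.sum_univ_castSucc, Fin.snoc_castSucc, Fin.snoc_last]
      simp only [Nat.cast_zero, Finset.sum_const_zero]
      linarith
    | cast i =>
      have h2 := h.2 i
      have hk' := hk i
      simp only [Fin.sum_univ_castSucc, Fin.snoc_castSucc, Fin.snoc_last, Nat.cast_zero]
      linarith

end IsRootCombination

/-- Sorting the root combinations for `γ` by the vector `a` that remains when the roots involving the
last coordinate are dropped. The finite set `B` is any set that contains all possible `a`. -/
def rootCombinationEquiv {n : ℕ} (γ : Fin (n + 1) → ℤ) (hγ : ∑ i, γ i = 0)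
    (B : Finset (Fin n → ℤ)) (hB : ∀ a, ∑ i, a i = 0 → (∀ i, a i ≤ γ i.castSucc) → a ∈ B) :
    {c // IsRootCombination γ c} ≃
      Σ a : {a // a ∈ B.filter fun a => ∀ i, a i ≤ γ i.castSucc},
        {c // IsRootCombination a.1 c} :=
  (Equiv.sigmaFiberEquiv (fun c : {c // IsRootCombination γ c} =>
    (⟨fun i => γ i.castSucc - c.1 i.castSucc (Fin.last n), by
      rw [Finset.mem_filter]
      have h : ∀ i : Fin n, γ i.castSucc - c.1 i.castSucc (Fin.last n) ≤ γ i.castSucc := by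
        intro i; omega
      exact ⟨hB _ c.2.restrict.sum_eq_zero h, h⟩⟩ :
      {a // a ∈ B.filter fun a => ∀ i, a i ≤ γ i.castSucc}))).symm.trans
  (Equiv.sigmaCongrRight fun a =>
    { toFun := fun c => ⟨fun i j => c.1.1 i.castSucc j.castSucc, by
        rw [← congrArg Subtype.val c.2]; exact c.1.2.restrict⟩
      invFun := fun c => ⟨⟨_, c.2.extend (fun i => (γ i.castSucc - a.1 i).toNat) (fun i => by
          have := (Finset.mem_filter.1 a.2).2 i
          omega) hγ⟩, by
        refine Subtype.ext (funext fun i => ?_)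
        have := (Finset.mem_filter.1 a.2).2 i
        simp only [Fin.snoc_castSucc, Fin.snoc_last]
        omega⟩
      left_inv := by
        rintro ⟨⟨c, hc⟩, h⟩
        subst h
        refine Subtype.ext (Subtype.ext (funext fun i => funext fun j => ?_))
        induction i using Fin.lastCases with
        | last => simpa using (hc.1 _ _ (Fin.le_last j).not_gt).symm
        | cast i =>
          induction j using Fin.lastCases with
          | last => simp
          | cast j => simp
      right_inv := by
        rintro ⟨c, hc⟩
        refine Subtype.ext (funext fun i => funext fun j => ?_)
        simp })

/-- Integer vectors with given sum and bounded above are bounded below. -/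
theorem le_of_sum_eq_of_forall_le {n : ℕ} (a : Fin n → ℤ) (s M : ℤ) (hs : ∑ i, a i = s)
    (hM : ∀ i, a i ≤ M) (i : Fin n) : s - n * |M| ≤ a i := by
  have h1 : ∑ j ∈ Finset.univ.erase i, a j ≤ ∑ j ∈ Finset.univ.erase i, |M| :=
    Finset.sum_le_sum fun j _ => (hM j).trans (le_abs_self M)
  have h2 : ∑ j ∈ Finset.univ.erase i, |M| ≤ ∑ j : Fin n, |M| :=
    Finset.sum_le_sum_of_subset_of_nonneg (Finset.subset_univ _) fun _ _ _ => abs_nonneg M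
  have h3 := Finset.add_sum_erase Finset.univ a (Finset.mem_univ i)
  simp only [Finset.sum_const, Finset.card_univ, Fintype.card_fin, nsmul_eq_mul] at h2
  simp only [Finset.sum_const, nsmul_eq_mul] at h1
  linarith

theorem exists_forall_le_fin {n : ℕ} (f : Fin n → ℤ) : ∃ M, ∀ i, f i ≤ M :=
  ⟨∑ i, |f i|, fun i => (le_abs_self _).trans
    (Finset.single_le_sum (f := fun i => |f i|) (fun _ _ => abs_nonneg _) (Finset.mem_univ i))⟩

instance finite_isRootCombination {n : ℕ} (γ : Fin n → ℤ) :
    Finite {c // IsRootCombination γ c} := by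
  induction n with
  | zero => infer_instance
  | succ n ih =>
    by_cases hγ : ∑ i, γ i = 0
    · obtain ⟨M, hM⟩ := exists_forall_le_fin fun i : Fin n => γ i.castSucc
      have hB : ∀ a : Fin n → ℤ, ∑ i, a i = 0 → (∀ i, a i ≤ γ i.castSucc) →
          a ∈ Fintype.piFinset fun _ => Finset.Icc (0 - n * |M|) M := fun a ha h =>
        Fintype.mem_piFinset.2 fun i => Finset.mem_Icc.2
          ⟨le_of_sum_eq_of_forall_le a 0 M ha (fun i => (h i).trans (hM i)) i, (h i).trans (hM i)⟩
      exact Finite.of_equiv _ (rootCombinationEquiv γ hγ _ hB).symm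
    · exact @Finite.of_subsingleton _ ⟨fun c => absurd c.2.sum_eq_zero hγ⟩

theorem kostantCount_eq_zero {n : ℕ} {γ : Fin n → ℤ} (hγ : ∑ i, γ i ≠ 0) : kostantCount γ = 0 := by
  have : IsEmpty {c // IsRootCombination γ c} := ⟨fun c => hγ c.2.sum_eq_zero⟩
  exact Nat.card_of_isEmpty

theorem kostantCount_succ {n : ℕ} (γ : Fin (n + 1) → ℤ) (hγ : ∑ i, γ i = 0)
    (B : Finset (Fin n → ℤ)) (hB : ∀ a, ∑ i, a i = 0 → (∀ i, a i ≤ γ i.castSucc) → a ∈ B) :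
    kostantCount γ = ∑ a ∈ B, if ∀ i, a i ≤ γ i.castSucc then kostantCount a else 0 := by
  rw [kostantCount, Nat.card_congr (rootCombinationEquiv γ hγ B hB), Nat.card_sigma,
    ← Finset.sum_filter]
  refine Eq.trans ?_
    (Finset.sum_coe_sort (B.filter fun a => ∀ i, a i ≤ γ i.castSucc) fun a => kostantCount a)
  exact Finset.sum_congr rfl fun _ _ => rfl

/-- The alternating sum `∑_w (-1)^w P(w(l) - δ - μ)` of Kostant's weight multiplicity formula, where
`P` is the Kostant partition function. The vector `l` stands for `λ + δ`. -/
noncomputable def signedKostantSum {n : ℕ} (l μ : Fin n → ℤ) : ℤ :=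
  ∑ w : Equiv.Perm (Fin n), (Equiv.Perm.sign w : ℤ) *
    kostantCount (permuteVector w l - staircase n - μ)

theorem sum_permuteVector_sub {n : ℕ} (w : Equiv.Perm (Fin n)) (l μ : Fin n → ℤ) :
    ∑ i, (permuteVector w l - staircase n - μ) i =
      ∑ i, l i - ∑ i, staircase n i - ∑ i, μ i := by
  simp only [Pi.sub_apply, Finset.sum_sub_distrib, permuteVector]
  rw [Equiv.sum_comp w⁻¹ l]

theorem signedKostantSum_eq_zero {n : ℕ} {l μ : Fin n → ℤ}
    (h : ∑ i, l i ≠ ∑ i, staircase n i + ∑ i, μ i) : signedKostantSum l μ = 0 := by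
  refine Finset.sum_eq_zero fun w _ => ?_
  rw [kostantCount_eq_zero, Nat.cast_zero, mul_zero]
  rw [sum_permuteVector_sub]
  omega

/-- The branching rule for the alternating sum: it is the sum of its lower-dimensional versions over
all vectors `b` that interlace with `l`. -/
theorem signedKostantSum_succ {n : ℕ} {l μ : Fin (n + 1) → ℤ} (hl : Antitone l)
    (h : ∑ i, l i = ∑ i, staircase (n + 1) i + ∑ i, μ i) :
    signedKostantSum l μ = ∑ b ∈ Fintype.piFinset (fun i : Fin n =>
      Finset.Ico (l i.succ) (l i.castSucc)), signedKostantSum b (fun i => μ i.castSucc) := by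
  set μ' : Fin n → ℤ := fun i => μ i.castSucc
  set s : ℤ := ∑ i, staircase n i + ∑ i, μ' i
  obtain ⟨M, hM⟩ := exists_forall_le_fin l
  obtain ⟨L, hL⟩ := exists_forall_le_fin fun i => -l i
  have key := sum_sign_mul_sum_lt (fun a => (kostantCount (a - staircase n - μ') : ℤ)) l hl
    (min (-L) (s - n * |M|)) M (fun i => (min_le_left _ _).trans (neg_le.1 (hL i))) hM
  refine Eq.trans ?_ key
  refine Finset.sum_congr rfl fun w _ => congrArg _ ?_
  have hstair : ∀ i : Fin n, staircase (n + 1) i.castSucc = staircase n i + 1 := by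
    intro i; simp only [staircase, Fin.val_castSucc]; push_cast; ring
  have hshift : ∀ (a : Fin n → ℤ), (∀ i, (a - (staircase n + μ')) i ≤
      (permuteVector w l - staircase (n + 1) - μ) i.castSucc) ↔
      ∀ i, a i < l (w⁻¹ i.castSucc) := fun a => forall_congr' fun i => by
    simp only [Pi.sub_apply, Pi.add_apply, permuteVector, hstair, μ']
    omega
  rw [kostantCount_succ (permuteVector w l - staircase (n + 1) - μ)
    (by rw [sum_permuteVector_sub]; omega)
    ((Fintype.piFinset fun _ => Finset.Ico (min (-L) (s - n * |M|)) M).map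
      (Equiv.subRight (staircase n + μ')).toEmbedding)]
  · rw [Finset.sum_map]
    simp only [Equiv.coe_toEmbedding, Equiv.subRight_apply, hshift, Nat.cast_sum, Nat.cast_ite,
      Nat.cast_zero]
    simp only [sub_sub]
  · intro a ha0 ha
    rw [Finset.mem_map_equiv]
    have ha' : ∀ i, (a + (staircase n + μ')) i < l (w⁻¹ i.castSucc) :=
      (hshift _).1 (by simpa only [add_sub_cancel_right] using ha)
    have hs : ∑ i, (a + (staircase n + μ')) i = s := by
      simp only [Pi.add_apply, Finset.sum_add_distrib, ha0, zero_add, s]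
    exact Fintype.mem_piFinset.2 fun i => Finset.mem_Ico.2
      ⟨(min_le_right _ _).trans (le_of_sum_eq_of_forall_le _ s M hs
        (fun i => (ha' i).le.trans (hM _)) i), (ha' i).trans_le (hM _)⟩

/-! ### Semistandard tableaux -/

/-- The number of cells with entry `k` in the first `m` rows of the filling `T` of the shape whose
row lengths are `r`. -/
def entryCount (m : ℕ) (r : ℕ → ℕ) (T : ℕ → ℕ → ℕ) (k : ℕ) : ℕ :=
  ∑ i ∈ Finset.range m, ((Finset.range (r i)).filter fun j => T i j = k).card

/-- `T` is a semistandard tableau with entries in `{0, …, n - 1}`, of the shape with row lengths `r`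
and of weight `(μ_0, …, μ_{n-1})`. The shape is a function rather than a `YoungDiagram`, so that
tableaux of different shapes live in the same type; only shapes with `r` antitone and `r i = 0` for
`n ≤ i` are relevant. As in `SemistandardYoungTableau`, the filling is zero outside the shape. -/
structure IsTableau (n : ℕ) (r μ : ℕ → ℕ) (T : ℕ → ℕ → ℕ) : Prop where
  row_weak : ∀ {i j₁ j₂ : ℕ}, j₁ < j₂ → j₂ < r i → T i j₁ ≤ T i j₂
  col_strict : ∀ {i₁ i₂ j : ℕ}, i₁ < i₂ → j < r i₂ → T i₁ j < T i₂ j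
  zeros : ∀ {i j : ℕ}, r i ≤ j → T i j = 0
  entry_lt : ∀ {i j : ℕ}, j < r i → T i j < n
  weight : ∀ k < n, entryCount n r T k = μ k

/-- The number of semistandard tableaux of shape `r` and weight `(μ_0, …, μ_{n-1})`. -/
noncomputable def tableauCount (n : ℕ) (r μ : ℕ → ℕ) : ℕ := Nat.card {T // IsTableau n r μ T}

theorem sum_entryCount {n : ℕ} {r : ℕ → ℕ} {T : ℕ → ℕ → ℕ} (h : ∀ i j, j < r i → T i j < n)
    (m : ℕ) : ∑ k ∈ Finset.range n, entryCount m r T k = ∑ i ∈ Finset.range m, r i := by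
  simp only [entryCount]
  rw [Finset.sum_comm]
  refine Finset.sum_congr rfl fun i _ => ?_
  rw [← Finset.card_eq_sum_card_fiberwise, Finset.card_range]
  intro j hj
  simpa using h i j (by simpa using hj)

/-- A subset of `{0, …, m - 1}` that is closed downwards is an initial segment. -/
theorem lt_card_filter_range_iff {p : ℕ → Prop} [DecidablePred p] {m : ℕ}
    (hp : ∀ j₁ j₂, j₁ < j₂ → j₂ < m → p j₂ → p j₁) {j : ℕ} (hj : j < m) :
    j < ((Finset.range m).filter p).card ↔ p j := by
  induction m with
  | zero => omega
  | succ m ih =>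
    by_cases hm : p m
    · have hall : ∀ j < m + 1, p j := fun j hj => by
        rcases Nat.lt_succ_iff_lt_or_eq.1 hj with h | rfl
        · exact hp j m h (Nat.lt_succ_self m) hm
        · exact hm
      rw [Finset.filter_true_of_mem fun j hj => hall j (Finset.mem_range.1 hj), Finset.card_range]
      exact iff_of_true hj (hall j hj)
    · rw [Finset.range_add_one, Finset.filter_insert, if_neg hm]
      rcases Nat.lt_succ_iff_lt_or_eq.1 hj with h | rfl
      · exact ih (fun j₁ j₂ h₁ h₂ => hp j₁ j₂ h₁ (h₂.trans (Nat.lt_succ_self m))) h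
      · refine iff_of_false (not_lt.2 ?_) hm
        exact (Finset.card_filter_le _ _).trans_eq (Finset.card_range j)

/-- The row lengths of the part of the filling `T` with entries less than `n`. -/
def innerShape (n : ℕ) (r : ℕ → ℕ) (T : ℕ → ℕ → ℕ) (i : ℕ) : ℕ :=
  ((Finset.range (r i)).filter fun j => T i j < n).card

theorem entryCount_congr {m : ℕ} {r r' : ℕ → ℕ} {T T' : ℕ → ℕ → ℕ} {k : ℕ}
    (h : ∀ i j, (j < r i ∧ T i j = k) ↔ (j < r' i ∧ T' i j = k)) :
    entryCount m r T k = entryCount m r' T' k := by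
  refine Finset.sum_congr rfl fun i _ => congrArg Finset.card (Finset.ext fun j => ?_)
  simpa only [Finset.mem_filter, Finset.mem_range] using h i j

theorem entryCount_succ {m : ℕ} {r : ℕ → ℕ} {T : ℕ → ℕ → ℕ} {k : ℕ} (hr : r m = 0) :
    entryCount (m + 1) r T k = entryCount m r T k := by
  simp [entryCount, Finset.sum_range_succ, hr]

namespace IsTableau

variable {n : ℕ} {r μ ν : ℕ → ℕ} {T : ℕ → ℕ → ℕ}

theorem sum_eq (h : IsTableau n r μ T) :
    ∑ i ∈ Finset.range n, r i = ∑ k ∈ Finset.range n, μ k := by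
  rw [← sum_entryCount (fun _ _ => h.entry_lt) n]
  exact Finset.sum_congr rfl fun k hk => h.weight k (Finset.mem_range.1 hk)

theorem le_entry (h : IsTableau n r μ T) (hr : Antitone r) {i j : ℕ} (hj : j < r i) :
    i ≤ T i j := by
  induction i with
  | zero => exact Nat.zero_le _
  | succ i ih =>
    exact (ih (hj.trans_le (hr i.le_succ))).trans_lt (h.col_strict i.lt_succ_self hj)

theorem lt_innerShape_iff (h : IsTableau (n + 1) r μ T) {i j : ℕ} :
    j < innerShape n r T i ↔ j < r i ∧ T i j < n := by
  by_cases hj : j < r i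
  · rw [innerShape, lt_card_filter_range_iff _ hj]
    · simp [hj]
    · exact fun j₁ j₂ h₁ h₂ h₃ => (h.row_weak h₁ h₂).trans_lt h₃
  · refine iff_of_false (fun h' => hj (h'.trans_le ?_)) fun h' => hj h'.1
    exact (Finset.card_filter_le _ _).trans_eq (Finset.card_range _)

theorem innerShape_le (h : IsTableau (n + 1) r μ T) (i : ℕ) : innerShape n r T i ≤ r i :=
  le_of_forall_lt fun _ hj => (h.lt_innerShape_iff.1 hj).1

theorem le_innerShape (h : IsTableau (n + 1) r μ T) (hr : Antitone r) (i : ℕ) :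
    r (i + 1) ≤ innerShape n r T i :=
  le_of_forall_lt fun _ hj => h.lt_innerShape_iff.2 ⟨hj.trans_le (hr i.le_succ),
    (h.col_strict i.lt_succ_self hj).trans_le (Nat.lt_succ_iff.1 (h.entry_lt hj))⟩

theorem innerShape_eq_zero (h : IsTableau (n + 1) r μ T) (hr : Antitone r) {i : ℕ} (hi : n ≤ i) :
    innerShape n r T i = 0 := by
  refine Nat.eq_zero_of_not_pos fun h0 => ?_
  have := h.lt_innerShape_iff.1 h0
  exact absurd (h.le_entry hr this.1) (by omega)

/-- Removing the cells with the largest entry leaves a tableau of the inner shape. -/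
theorem restrict (h : IsTableau (n + 1) r μ T) (hr : Antitone r) (hν : innerShape n r T = ν) :
    IsTableau n ν μ fun i j => if j < ν i then T i j else 0 := by
  subst hν
  have hlt := fun i j => h.lt_innerShape_iff (i := i) (j := j)
  refine ⟨fun {i j₁ j₂} hj h₂ => ?_, fun {i₁ i₂ j} hi h₂ => ?_, fun h₀ => if_neg h₀.not_gt,
    fun h₀ => ?_, fun k hk => ?_⟩
  · simp only [if_pos h₂, if_pos (hj.trans h₂)]
    exact h.row_weak hj ((hlt _ _).1 h₂).1
  · -- `j < r i₂ ≤ r (i₁ + 1) ≤ innerShape n r T i₁`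
    have h₁ : j < innerShape n r T i₁ :=
      ((h₂.trans_le (h.innerShape_le i₂)).trans_le (hr hi)).trans_le (h.le_innerShape hr i₁)
    simp only [if_pos h₂, if_pos h₁]
    exact h.col_strict hi ((hlt _ _).1 h₂).1
  · simp only [if_pos h₀]
    exact ((hlt _ _).1 h₀).2
  · rw [← h.weight k (hk.trans n.lt_succ_self),
      ← entryCount_succ (h.innerShape_eq_zero hr le_rfl)]
    refine entryCount_congr fun i j => ?_
    constructor
    · rintro ⟨h₁, h₂⟩
      rw [if_pos h₁] at h₂
      exact ⟨((hlt _ _).1 h₁).1, h₂⟩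
    · rintro ⟨h₁, h₂⟩
      have h₃ := (hlt i j).2 ⟨h₁, h₂ ▸ hk⟩
      exact ⟨h₃, by rw [if_pos h₃, h₂]⟩

/-- A tableau of a shape `ν` that interlaces with `r` becomes one of shape `r` when the new cells are
filled with `n`. The weight condition for the entry `n` follows from the total number of cells. -/
theorem extend (h : IsTableau n ν μ T) (hr : Antitone r) (hνr : ∀ i, ν i ≤ r i)
    (hrν : ∀ i, r (i + 1) ≤ ν i) (hν : ν n = 0)
    (hsum : ∑ i ∈ Finset.range (n + 1), r i = ∑ k ∈ Finset.range (n + 1), μ k) :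
    IsTableau (n + 1) r μ fun i j => if j < ν i then T i j else if j < r i then n else 0 := by
  have hlt : ∀ i j, j < r i → (if j < ν i then T i j else if j < r i then n else 0) < n + 1 := by
    intro i j hj
    split_ifs with h₁
    · exact (h.entry_lt h₁).trans n.lt_succ_self
    · exact n.lt_succ_self
  have hweight : ∀ k < n, entryCount (n + 1) r
      (fun i j => if j < ν i then T i j else if j < r i then n else 0) k = μ k := by
    intro k hk
    rw [← h.weight k hk, ← entryCount_succ hν]
    refine entryCount_congr fun i j => ?_
    have := hνr i
    by_cases h₁ : j < ν i
    · simp [h₁, h₁.trans_le this]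
    · simp only [h₁, if_false, false_and, iff_false]
      rintro ⟨h₂, h₃⟩
      rw [if_pos h₂] at h₃
      omega
  refine ⟨fun {i j₁ j₂} hj h₂ => ?_, fun {i₁ i₂ j} hi h₂ => ?_, fun {i j} h₀ => ?_,
    fun {i j} h₀ => hlt i j h₀, fun k hk => ?_⟩
  · by_cases h₃ : j₂ < ν i
    · simpa only [if_pos h₃, if_pos (hj.trans h₃)] using h.row_weak hj h₃
    · simp only [if_neg h₃, if_pos h₂]
      exact Nat.lt_succ_iff.1 (hlt i j₁ (hj.trans h₂))
  · have h₁ : j < ν i₁ := (h₂.trans_le (hr hi)).trans_le (hrν i₁)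
    simp only [if_pos h₁, if_pos h₂]
    split_ifs with h₃
    · exact h.col_strict hi h₃
    · exact h.entry_lt h₁
  · simp only [if_neg h₀.not_gt, if_neg ((hνr i).trans h₀).not_gt]
  · rcases Nat.lt_succ_iff_lt_or_eq.1 hk with hk | rfl
    · exact hweight k hk
    · have htot := sum_entryCount hlt (k + 1)
      rw [hsum, Finset.sum_range_succ, Finset.sum_range_succ,
        Finset.sum_congr rfl fun i hi => hweight i (Finset.mem_range.1 hi)] at htot
      exact Nat.add_left_cancel htot

end IsTableau

/-- A vector of length `n`, continued by zeros to an infinite sequence. -/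
def extendByZero {n : ℕ} (ν : Fin n → ℕ) (i : ℕ) : ℕ := if h : i < n then ν ⟨i, h⟩ else 0

theorem extendByZero_coe {n : ℕ} (ν : Fin n → ℕ) (i : Fin n) : extendByZero ν i = ν i := by
  simp [extendByZero]

theorem extendByZero_of_le {n : ℕ} (ν : Fin n → ℕ) {i : ℕ} (hi : n ≤ i) :
    extendByZero ν i = 0 := by
  simp [extendByZero, hi.not_gt]

/-- The shapes with `n` rows that interlace with `r`, that is, `r_{i+1} ≤ ν_i ≤ r_i`. -/
def interlacing (n : ℕ) (r : ℕ → ℕ) : Finset (Fin n → ℕ) :=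
  Fintype.piFinset fun i => Finset.Icc (r (i + 1)) (r i)

theorem le_extendByZero_of_mem {n : ℕ} {r : ℕ → ℕ} (hr : ∀ i, n < i → r i = 0) {ν : Fin n → ℕ}
    (hν : ν ∈ interlacing n r) (i : ℕ) : r (i + 1) ≤ extendByZero ν i := by
  by_cases hi : i < n
  · have := Finset.mem_Icc.1 (Fintype.mem_piFinset.1 hν ⟨i, hi⟩)
    simpa [extendByZero, hi] using this.1
  · simp [hr (i + 1) (by omega)]

theorem extendByZero_le_of_mem {n : ℕ} {r : ℕ → ℕ} {ν : Fin n → ℕ}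
    (hν : ν ∈ interlacing n r) (i : ℕ) : extendByZero ν i ≤ r i := by
  by_cases hi : i < n
  · have := Finset.mem_Icc.1 (Fintype.mem_piFinset.1 hν ⟨i, hi⟩)
    simpa [extendByZero, hi] using this.2
  · simp [extendByZero, hi]

theorem extendByZero_innerShape {n : ℕ} {r μ : ℕ → ℕ} {T : ℕ → ℕ → ℕ} (hr : Antitone r)
    (h : IsTableau (n + 1) r μ T) :
    extendByZero (fun i : Fin n => innerShape n r T i) = innerShape n r T := by
  funext i
  by_cases hi : i < n
  · simp [extendByZero, hi]
  · rw [extendByZero_of_le _ (not_lt.1 hi), h.innerShape_eq_zero hr (not_lt.1 hi)]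

theorem innerShape_extend {n : ℕ} {r μ ν : ℕ → ℕ} {T : ℕ → ℕ → ℕ} (h : IsTableau n ν μ T)
    (hνr : ∀ i, ν i ≤ r i) :
    innerShape n r (fun i j => if j < ν i then T i j else if j < r i then n else 0) = ν := by
  funext i
  rw [innerShape]
  convert Finset.card_range (ν i) using 2
  ext j
  have := hνr i
  simp only [Finset.mem_filter, Finset.mem_range]
  split_ifs with h₁ h₂
  · exact iff_of_true ⟨h₁.trans_le this, h.entry_lt h₁⟩ h₁
  · simp [h₁]
  · simp [h₁, h₂]

/-- Sorting the tableaux of shape `r` by the shape that remains when the cells with the largest entry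
are removed. -/
def tableauEquiv {n : ℕ} {r μ : ℕ → ℕ} (hr : Antitone r) (hr0 : ∀ i, n < i → r i = 0)
    (hsum : ∑ i ∈ Finset.range (n + 1), r i = ∑ k ∈ Finset.range (n + 1), μ k) :
    {T // IsTableau (n + 1) r μ T} ≃
      Σ ν : interlacing n r, {T // IsTableau n (extendByZero ν.1) μ T} :=
  (Equiv.sigmaFiberEquiv (fun T : {T // IsTableau (n + 1) r μ T} =>
    (⟨fun i : Fin n => innerShape n r T.1 i, Fintype.mem_piFinset.2 fun i => Finset.mem_Icc.2
      ⟨T.2.le_innerShape hr i, T.2.innerShape_le i⟩⟩ : interlacing n r))).symm.trans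
  (Equiv.sigmaCongrRight fun ν =>
    { toFun := fun T => ⟨_, T.1.2.restrict hr (by
        rw [← extendByZero_innerShape hr T.1.2]
        exact congrArg extendByZero (congrArg Subtype.val T.2))⟩
      invFun := fun T => ⟨⟨_, T.2.extend hr (extendByZero_le_of_mem ν.2)
        (le_extendByZero_of_mem hr0 ν.2) (extendByZero_of_le _ le_rfl) hsum⟩, by
        refine Subtype.ext (funext fun i => ?_)
        simp only [innerShape_extend T.2 (extendByZero_le_of_mem ν.2), extendByZero_coe]⟩
      left_inv := by
        rintro ⟨⟨T, hT⟩, h⟩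
        subst h
        refine Subtype.ext (Subtype.ext (funext fun i => funext fun j => ?_))
        simp only [extendByZero_innerShape hr hT]
        have h₁ := hT.lt_innerShape_iff (i := i) (j := j)
        split_ifs with h₂ h₃
        · rfl
        · have := hT.entry_lt h₃
          have : ¬ T i j < n := fun h => h₂ (h₁.2 ⟨h₃, h⟩)
          omega
        · exact (hT.zeros (not_lt.1 h₃)).symm
      right_inv := by
        rintro ⟨T, hT⟩
        refine Subtype.ext (funext fun i => funext fun j => ?_)
        simp only
        split_ifs with h₁
        · rfl
        · exact (hT.zeros (not_lt.1 h₁)).symm })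

theorem isTableau_zero_iff {r μ : ℕ → ℕ} (hr0 : ∀ i, r i = 0) {T : ℕ → ℕ → ℕ} :
    IsTableau 0 r μ T ↔ T = fun _ _ => 0 := by
  constructor
  · intro h
    funext i j
    exact h.zeros (by simp [hr0])
  · rintro rfl
    exact ⟨by simp, by simp [hr0], by simp, by simp [hr0], by simp⟩

theorem antitone_extendByZero {n : ℕ} {r : ℕ → ℕ} (hr0 : ∀ i, n < i → r i = 0)
    {ν : Fin n → ℕ} (hν : ν ∈ interlacing n r) : Antitone (extendByZero ν) :=
  antitone_nat_of_succ_le fun i =>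
    (extendByZero_le_of_mem hν (i + 1)).trans (le_extendByZero_of_mem hr0 hν i)

theorem finite_isTableau {n : ℕ} {r : ℕ → ℕ} (μ : ℕ → ℕ) (hr : Antitone r)
    (hr0 : ∀ i, n ≤ i → r i = 0) : Finite {T // IsTableau n r μ T} := by
  induction n generalizing r with
  | zero =>
    simp only [isTableau_zero_iff fun i => hr0 i (Nat.zero_le i)]
    infer_instance
  | succ n ih =>
    by_cases hsum : ∑ i ∈ Finset.range (n + 1), r i = ∑ k ∈ Finset.range (n + 1), μ k
    · have := fun ν : interlacing n r =>
        ih (antitone_extendByZero hr0 ν.2) fun i => extendByZero_of_le ν.1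
      exact Finite.of_equiv _ (tableauEquiv hr hr0 hsum).symm
    · exact @Finite.of_subsingleton _ ⟨fun T => absurd T.2.sum_eq hsum⟩

theorem tableauCount_succ {n : ℕ} {r μ : ℕ → ℕ} (hr : Antitone r) (hr0 : ∀ i, n < i → r i = 0)
    (hsum : ∑ i ∈ Finset.range (n + 1), r i = ∑ k ∈ Finset.range (n + 1), μ k) :
    tableauCount (n + 1) r μ = ∑ ν ∈ interlacing n r, tableauCount n (extendByZero ν) μ := by
  have := fun ν : interlacing n r =>
    finite_isTableau μ (antitone_extendByZero hr0 ν.2) fun i => extendByZero_of_le ν.1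
  rw [tableauCount, Nat.card_congr (tableauEquiv hr hr0 hsum), Nat.card_sigma]
  refine Eq.trans ?_
    (Finset.sum_coe_sort (interlacing n r) fun ν => tableauCount n (extendByZero ν) μ)
  exact Finset.sum_congr rfl fun _ _ => rfl

theorem tableauCount_eq_zero {n : ℕ} {r μ : ℕ → ℕ}
    (hsum : ∑ i ∈ Finset.range n, r i ≠ ∑ k ∈ Finset.range n, μ k) : tableauCount n r μ = 0 := by
  have : IsEmpty {T // IsTableau n r μ T} := ⟨fun T => hsum T.2.sum_eq⟩
  exact Nat.card_of_isEmpty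

/-- Kostant's weight multiplicity formula for semistandard tableaux: both sides satisfy the same
branching rule. -/
theorem tableauCount_eq_signedKostantSum (n : ℕ) {r : ℕ → ℕ} (μ : ℕ → ℕ) (hr : Antitone r)
    (hr0 : ∀ i, n ≤ i → r i = 0) :
    (tableauCount n r μ : ℤ) =
      signedKostantSum (fun i : Fin n => (r i : ℤ) + staircase n i) (fun i => (μ i : ℤ)) := by
  induction n generalizing r with
  | zero =>
    have h1 : tableauCount 0 r μ = 1 := by
      simp only [tableauCount, isTableau_zero_iff fun i => hr0 i (Nat.zero_le i)]
      exact Nat.card_unique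
    have h2 : ∀ γ : Fin 0 → ℤ, kostantCount γ = 1 := fun γ => by
      have : Unique {c // IsRootCombination γ c} :=
        { default := ⟨Fin.elim0, fun i => i.elim0, fun i => i.elim0⟩
          uniq := fun c => Subsingleton.elim _ _ }
      exact Nat.card_unique
    simp [h1, signedKostantSum, h2]
  | succ n ih =>
    by_cases hsum : ∑ i ∈ Finset.range (n + 1), r i = ∑ k ∈ Finset.range (n + 1), μ k
    · rw [tableauCount_succ hr hr0 hsum, signedKostantSum_succ]
      · push_cast
        refine Finset.sum_bij' (fun ν _ i => (ν i : ℤ) + staircase n i)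
          (fun b _ i => (b i - staircase n i).toNat) ?_ ?_ ?_ ?_ ?_
        · intro ν hν
          refine Fintype.mem_piFinset.2 fun i => ?_
          have := Finset.mem_Icc.1 (Fintype.mem_piFinset.1 hν i)
          simp only [Finset.mem_Ico, staircase, Fin.val_succ, Fin.val_castSucc]
          omega
        · intro b hb
          refine Fintype.mem_piFinset.2 fun i => ?_
          have := Fintype.mem_piFinset.1 hb i
          simp only [Finset.mem_Ico, staircase, Fin.val_succ, Fin.val_castSucc] at this
          simp only [Finset.mem_Icc, staircase]
          omega
        · intro ν _
          funext i
          simp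
        · intro b hb
          funext i
          have := Fintype.mem_piFinset.1 hb i
          simp only [Finset.mem_Ico, staircase, Fin.val_succ, Fin.val_castSucc] at this
          simp only [staircase]
          omega
        · intro ν hν
          rw [ih (antitone_extendByZero hr0 hν) fun i => extendByZero_of_le ν]
          simp only [extendByZero_coe, Fin.val_castSucc]
      · intro i j hij
        have h₁ : r j ≤ r i := hr hij
        have h₂ : (i : ℕ) ≤ j := hij
        simp only [staircase]
        omega
      · rw [Finset.sum_add_distrib, add_comm, Fin.sum_univ_eq_sum_range (fun i => (r i : ℤ)),
          Fin.sum_univ_eq_sum_range (fun i => (μ i : ℤ))]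
        exact congrArg _ (by exact_mod_cast hsum)
    · rw [tableauCount_eq_zero hsum, signedKostantSum_eq_zero, Nat.cast_zero]
      rw [Finset.sum_add_distrib, add_comm, Fin.sum_univ_eq_sum_range (fun i => (r i : ℤ)),
          Fin.sum_univ_eq_sum_range (fun i => (μ i : ℤ))]
      intro h
      exact hsum (by exact_mod_cast add_left_cancel h)

/-! ### Kostka numbers -/

theorem kostkaNumber_eq_tableauCount {n : ℕ} {lam mu : YoungDiagram}
    (hlam : ∀ i, n ≤ i → lam.rowLen i = 0) (hmu : ∀ i, n ≤ i → mu.rowLen i = 0) :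
    kostkaNumber lam mu = tableauCount n lam.rowLen mu.rowLen := by
  have hcount : ∀ (T : ℕ → ℕ → ℕ) (k : ℕ),
      (lam.cells.filter fun c => T c.1 c.2 = k).card = entryCount n lam.rowLen T k := by
    intro T k
    rw [entryCount, Finset.card_eq_sum_card_fiberwise (f := Prod.fst) (t := Finset.range n)]
    · refine Finset.sum_congr rfl fun i _ => ?_
      refine Finset.card_nbij' Prod.snd (fun j => (i, j)) ?_ ?_ ?_ ?_
      · rintro ⟨i', j⟩
        simp only [Finset.coe_filter, Finset.mem_filter, YoungDiagram.mem_cells,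
          YoungDiagram.mem_iff_lt_rowLen, Finset.mem_range, Set.mem_ofPred_eq]
        rintro ⟨h, rfl⟩
        exact h
      · intro j
        simp [YoungDiagram.mem_iff_lt_rowLen]
      · rintro ⟨i', j⟩ h
        simp only [Finset.coe_filter, Set.mem_ofPred_eq] at h
        simp [h.2]
      · intro j _
        rfl
    · rintro ⟨i, j⟩ h
      simp only [Finset.coe_filter, YoungDiagram.mem_cells,
          YoungDiagram.mem_iff_lt_rowLen, Set.mem_ofPred_eq] at h
      simp only [Finset.coe_range, Set.mem_Iio]
      by_contra hi
      have := hlam i (not_lt.1 hi)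
      omega
  rw [kostkaNumber, ← Nat.card_coe_set_eq, tableauCount]
  refine Nat.card_congr
    { toFun := fun S => ⟨S.1.entry, ?_, ?_, ?_, ?_, ?_⟩
      invFun := fun T => ⟨⟨T.1, ?_, ?_, ?_⟩, ?_⟩
      left_inv := fun S => rfl
      right_inv := fun T => rfl }
  · exact fun hj h => S.1.row_weak hj (YoungDiagram.mem_iff_lt_rowLen.2 h)
  · exact fun hi h => S.1.col_strict hi (YoungDiagram.mem_iff_lt_rowLen.2 h)
  · exact fun h => S.1.zeros fun h' => h.not_gt (YoungDiagram.mem_iff_lt_rowLen.1 h')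
  · intro i j hj
    -- an entry `k ≥ n` would contribute to `mu.rowLen k = 0`
    by_contra hn
    have h0 := (S.2 (S.1 i j)).trans (hmu _ (not_lt.1 hn))
    rw [Finset.card_eq_zero, Finset.filter_eq_empty_iff] at h0
    exact h0 (x := (i, j)) ((YoungDiagram.mem_cells _).2 (YoungDiagram.mem_iff_lt_rowLen.2 hj)) rfl
  · exact fun k _ => (hcount _ k).symm.trans (S.2 k)
  · exact fun hj h => T.2.row_weak hj (YoungDiagram.mem_iff_lt_rowLen.1 h)
  · exact fun hi h => T.2.col_strict hi (YoungDiagram.mem_iff_lt_rowLen.1 h)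
  · exact fun h => T.2.zeros (not_lt.1 fun h' => h (YoungDiagram.mem_iff_lt_rowLen.2 h'))
  · intro k
    refine (hcount T.1 k).trans ?_
    by_cases hk : k < n
    · exact T.2.weight k hk
    · rw [hmu k (not_lt.1 hk)]
      refine Finset.sum_eq_zero fun i _ => ?_
      rw [Finset.card_eq_zero, Finset.filter_eq_empty_iff]
      intro j hj h
      have := T.2.entry_lt (Finset.mem_range.1 hj)
      omega

theorem rowLen_eq_zero_of_le {n : ℕ} {lam : YoungDiagram} (h : lam.rowLens.length ≤ n) {i : ℕ}
    (hi : n ≤ i) : lam.rowLen i = 0 := by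
  rw [YoungDiagram.length_rowLens] at h
  by_contra h0
  have := YoungDiagram.mem_iff_lt_colLen.1
    (YoungDiagram.mem_iff_lt_rowLen.2 (Nat.pos_of_ne_zero h0))
  omega

/-! ### The toppling group as a group of translations -/

open topplingGroup

theorem apply_eq_add_apply_zero {n : ℕ} (G : SimpleGraph (Fin n)) (g : topplingGroup G)
    (α : Fin n → ℤ) : g.1 α = α + g.1 0 := by
  obtain ⟨g, hg⟩ := g
  change g α = α + g 0
  induction hg using Subgroup.closure_induction generalizing α with
  | mem x hx =>
    obtain ⟨i, rfl⟩ := hx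
    simp [toppling]
  | one => simp
  | mul x y _ _ hx hy =>
    rw [Equiv.Perm.mul_apply, Equiv.Perm.mul_apply, hx (y α), hy α, hx (y 0), add_assoc]
  | inv x _ hx =>
    have h0 := hx (x⁻¹ 0)
    rw [show x (x⁻¹ 0) = 0 by simp] at h0
    rw [Equiv.Perm.inv_eq_iff_eq, hx, add_assoc, ← h0, add_zero]

/-- Every element of the toppling group is a translation; this is the homomorphism that sends it to
its vector. -/
def translationHom {n : ℕ} (G : SimpleGraph (Fin n)) :
    topplingGroup G →* Multiplicative (Fin n → ℤ) where
  toFun g := Multiplicative.ofAdd (g.1 0)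
  map_one' := rfl
  map_mul' g h := by
    rw [← ofAdd_add, add_comm]
    exact congrArg _ (apply_eq_add_apply_zero G g (h.1 0))

theorem translationHom_T {n : ℕ} (G : SimpleGraph (Fin n)) (i : Fin n) :
    translationHom G (T G i) = Multiplicative.ofAdd (topplingVector G i) := by
  change Multiplicative.ofAdd (toppling G i 0) = _
  simp [toppling]

theorem sum_neighborFinset_pathGraph {n : ℕ} {M : Type*} [AddCommMonoid M] (f : Fin n → M)
    (i : Fin n) [Fintype ((SimpleGraph.pathGraph n).neighborSet i)] :
    ∑ j ∈ (SimpleGraph.pathGraph n).neighborFinset i, f j =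
      (if h : (i : ℕ) + 1 < n then f ⟨i + 1, h⟩ else 0) +
        if 0 < (i : ℕ) then f ⟨i - 1, by omega⟩ else 0 := by
  have hN : (SimpleGraph.pathGraph n).neighborFinset i =
      (Finset.univ.filter fun j : Fin n => (i : ℕ) + 1 = j) ∪
        Finset.univ.filter fun j : Fin n => (j : ℕ) + 1 = i := by
    ext j
    simp [SimpleGraph.pathGraph_adj]
  rw [hN, Finset.sum_union]
  · congr 1
    · split_ifs with h
      · convert Finset.sum_singleton f ⟨i + 1, h⟩
        ext j
        simp [Fin.ext_iff, eq_comm]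
      · convert Finset.sum_empty
        ext j
        simp
        omega
    · split_ifs with h
      · convert Finset.sum_singleton f ⟨i - 1, by omega⟩
        ext j
        simp [Fin.ext_iff]
        omega
      · convert Finset.sum_empty
        ext j
        simp
        omega
  · rw [Finset.disjoint_filter]
    intro j _ h
    omega

/-- The vector of `T_i` is `(ε_{i+1} - ε_i) - (ε_i - ε_{i-1})`, where a difference is omitted if it
involves an index outside the path. -/
theorem topplingVector_pathGraph {n : ℕ} (i : Fin n) :
    topplingVector (SimpleGraph.pathGraph n) i =
      (if h : (i : ℕ) + 1 < n then Pi.single ⟨i + 1, h⟩ (1 : ℤ) - Pi.single i 1 else 0) +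
      if 0 < (i : ℕ) then Pi.single ⟨i - 1, by omega⟩ (1 : ℤ) - Pi.single i 1 else 0 := by
  classical
  rw [topplingVector, sum_neighborFinset_pathGraph, ← SimpleGraph.card_neighborFinset_eq_degree,
    Finset.card_eq_sum_ones, sum_neighborFinset_pathGraph]
  split_ifs <;> simp only [Nat.cast_add, Nat.cast_one, Nat.cast_zero, add_smul, one_smul,
    zero_smul] <;> abel

/-- The product `T_{[i]}` telescopes to the translation by `ε_{i+1} - ε_i`. (The condition on `i`
excludes the last vertex, for which the product is the identity.) -/
theorem translationHom_TInit {n i : ℕ} (hi : i + 1 < n) :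
    translationHom (SimpleGraph.pathGraph n) (TInit _ ⟨i, by omega⟩) =
      Multiplicative.ofAdd (Pi.single ⟨i + 1, hi⟩ (1 : ℤ) - Pi.single ⟨i, by omega⟩ 1) := by
  induction i with
  | zero =>
    have h0 : Finset.Iic (⟨0, by omega⟩ : Fin n) = {⟨0, by omega⟩} := by
      ext j
      simp [Fin.ext_iff, Fin.le_def]
    rw [TInit, h0, Finset.prod_singleton, translationHom_T, topplingVector_pathGraph]
    simp [hi]
  | succ i ih =>
    have h0 : Finset.Iic (⟨i + 1, by omega⟩ : Fin n) =
        insert ⟨i + 1, by omega⟩ (Finset.Iic ⟨i, by omega⟩) := by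
      ext j
      simp [Fin.ext_iff, Fin.le_def]
      omega
    rw [TInit, h0, Finset.prod_insert (by simp), map_mul, ← TInit, ih (by omega),
      translationHom_T, topplingVector_pathGraph, ← ofAdd_add]
    refine congrArg Multiplicative.ofAdd ?_
    simp only [hi, dif_pos, Nat.succ_pos, if_true, Nat.add_sub_cancel]
    abel

/-- The generator `T_{[i,j]}` is the translation by the negative root `ε_j - ε_i`. -/
theorem translationHom_TInterval {n : ℕ} {i j : Fin n} (hij : i ≤ j) :
    translationHom (SimpleGraph.pathGraph n) (TInterval _ i j) =
      Multiplicative.ofAdd (Pi.single j (1 : ℤ) - Pi.single i 1) := by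
  obtain ⟨j, hj⟩ := j
  obtain ⟨i, hi⟩ := i
  replace hij : i ≤ j := hij
  induction j, hij using Nat.le_induction with
  | base => simp [TInterval]
  | succ j hij ih =>
    have h0 : Finset.Ico (⟨i, hi⟩ : Fin n) ⟨j + 1, hj⟩ =
        insert ⟨j, by omega⟩ (Finset.Ico ⟨i, hi⟩ ⟨j, by omega⟩) := by
      ext k
      simp [Fin.ext_iff, Fin.le_def, Fin.lt_def]
      omega
    rw [TInterval, h0, Finset.prod_insert (by simp), map_mul, ← TInterval, ih (by omega),
      translationHom_TInit hj, ← ofAdd_add]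
    simp

/-! ### Decompositions as root combinations -/

theorem mem_decompositions_iff {n : ℕ} (α β : Fin n → ℤ)
    (s : Multiset {p : Fin n × Fin n // p.1 < p.2}) :
    (∃ g : topplingGroup (SimpleGraph.pathGraph n), g.1 α = β ∧ s ∈ decompositions _ g) ↔
      (s.map fun p => (Pi.single p.1.1 (1 : ℤ) - Pi.single p.1.2 1 : Fin n → ℤ)).sum = α - β := by
  have hs : translationHom (SimpleGraph.pathGraph n)
      (s.map fun p => TInterval _ p.1.1 p.1.2).prod = Multiplicative.ofAdd
        (-(s.map fun p => (Pi.single p.1.1 (1 : ℤ) - Pi.single p.1.2 1 : Fin n → ℤ)).sum) := by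
    induction s using Multiset.induction with
    | empty => simp
    | cons p s ih =>
      rw [Multiset.map_cons, Multiset.prod_cons, map_mul, ih, Multiset.map_cons, Multiset.sum_cons,
        translationHom_TInterval p.2.le, ← ofAdd_add, neg_add, neg_sub]
  have hs' : ((s.map fun p => TInterval (SimpleGraph.pathGraph n) p.1.1 p.1.2).prod).1 α =
      α - (s.map fun p => (Pi.single p.1.1 (1 : ℤ) - Pi.single p.1.2 1 : Fin n → ℤ)).sum := by
    rw [apply_eq_add_apply_zero, sub_eq_add_neg]
    exact congrArg _ hs
  simp only [decompositions, Set.mem_ofPred_eq]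
  constructor
  · rintro ⟨g, hg, rfl⟩
    rw [← hg, hs', sub_sub_cancel]
  · intro h
    exact ⟨_, by rw [hs', h, sub_sub_cancel], rfl⟩

/-- A multiset of pairs `i < j`, given by its multiplicities as a strictly upper triangular
matrix. -/
def decompositionEquiv (n : ℕ) : Multiset {p : Fin n × Fin n // p.1 < p.2} ≃
    {c : Fin n → Fin n → ℕ // ∀ i j, ¬ i < j → c i j = 0} where
  toFun s := ⟨fun i j => if h : i < j then s.count ⟨(i, j), h⟩ else 0, fun i j h => dif_neg h⟩
  invFun c := ∑ p : {p : Fin n × Fin n // p.1 < p.2}, Multiset.replicate (c.1 p.1.1 p.1.2) p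
  left_inv s := by
    ext p
    rw [Multiset.count_sum']
    simp [Multiset.count_replicate, p.2]
  right_inv c := by
    refine Subtype.ext (funext fun i => funext fun j => ?_)
    by_cases h : i < j
    · simp [h, Multiset.count_sum', Multiset.count_replicate]
    · simp [h, c.2 i j h]

theorem sum_map_roots_eq {n : ℕ} (s : Multiset {p : Fin n × Fin n // p.1 < p.2}) (i : Fin n) :
    (s.map fun p => (Pi.single p.1.1 (1 : ℤ) - Pi.single p.1.2 1 : Fin n → ℤ)).sum i =
      ∑ j, ((decompositionEquiv n s).1 i j : ℤ) - ∑ j, ((decompositionEquiv n s).1 j i : ℤ) := by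
  induction s using Multiset.induction with
  | empty => simp [decompositionEquiv]
  | cons p s ih =>
    obtain ⟨⟨a, b⟩, hab⟩ := p
    have hadd : ∀ i j, ((decompositionEquiv n (⟨(a, b), hab⟩ ::ₘ s)).1 i j : ℤ) =
        (decompositionEquiv n s).1 i j + (Pi.single a (1 : ℤ) : Fin n → ℤ) i *
          (Pi.single b (1 : ℤ) : Fin n → ℤ) j := by
      intro i j
      simp only [decompositionEquiv, Equiv.coe_fn_mk, Multiset.count_cons, Subtype.mk.injEq,
        Prod.mk.injEq, Pi.single_apply]
      split_ifs <;> simp_all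
    rw [Multiset.map_cons, Multiset.sum_cons, Pi.add_apply, ih]
    simp only [hadd, Finset.sum_add_distrib, ← Finset.mul_sum, ← Finset.sum_mul,
      Finset.sum_pi_single', Finset.mem_univ, if_true, Pi.sub_apply]
    ring

theorem decompositionCount_pathGraph {n : ℕ} (α β : Fin n → ℤ) :
    decompositionCount (SimpleGraph.pathGraph n) α β = kostantCount (α - β) := by
  rw [decompositionCount, ← Nat.card_coe_set_eq, kostantCount]
  refine Nat.card_congr (((decompositionEquiv n).subtypeEquiv
    (q := fun c => ∀ i, ∑ j, (c.1 i j : ℤ) - ∑ j, (c.1 j i : ℤ) = (α - β) i)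
      fun s => ?_).trans (Equiv.subtypeSubtypeEquivSubtypeInter
        (fun c : Fin n → Fin n → ℕ => ∀ i j, ¬ i < j → c i j = 0)
        fun c => ∀ i, ∑ j, (c i j : ℤ) - ∑ j, (c j i : ℤ) = (α - β) i))
  rw [Set.mem_ofPred_eq, mem_decompositions_iff, funext_iff]
  simp only [sum_map_roots_eq]

theorem mainTheorem6 (n : ℕ) (lam mu : YoungDiagram)
    (hlam : lam.rowLens.length ≤ n) (hmu : mu.rowLens.length ≤ n)
    (hdom : ToppleDominates (SimpleGraph.pathGraph n) (partVector n lam) (partVector n mu)) :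
    (kostkaNumber lam mu : ℤ) =
      ∑ w : Equiv.Perm (Fin n), (Equiv.Perm.sign w : ℤ) *
        (decompositionCount (SimpleGraph.pathGraph n)
          (permuteVector w (partVector n lam) + permuteVector w (staircase n) - staircase n)
          (partVector n mu) : ℤ) := by
  rw [kostkaNumber_eq_tableauCount (fun _ => rowLen_eq_zero_of_le hlam)
      fun _ => rowLen_eq_zero_of_le hmu,
    tableauCount_eq_signedKostantSum n _ (fun _ _ h => lam.rowLen_anti _ _ h)
      fun _ => rowLen_eq_zero_of_le hlam]
  refine Finset.sum_congr rfl fun w _ => ?_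
  rw [decompositionCount_pathGraph]
  rfl
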